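/- Let $P$ be a countable right Ore monoid: for all $x_1,x_2\in P$ there are $y_1,y_2\in P$ with $x_1y_1=x_2y_2$, and $xy_1=xy_2$ implies $y_1z=y_2z$ for some $z\in P$. Let $G=\{pq^{-1}\mid p,q\in P\}$ be its group completion; here $p_1q_1^{-1}=p_2q_2^{-1}$ if and only if $p_1t_1=p_2t_2$ and $q_1t_1=q_2t_2$ for some $t_1,t_2\in P$. Let $X$ be a second countable, locally compact Hausdorff space with an action of $P$ by proper topological correspondences. That is, for each $p\in P$ there are a locally compact Hausdorff space $M_p$, a proper continuous map $r_p\colon M_p\to X$ and a local homeomorphism $s_p\colon M_p\to X$, with $M_1=X$ and $r_1=s_1=\mathrm{id}_X$; and for all $p,q\in P$ there are homeomorphisms $\sigma_{p,q}=(r_{p,q},s_{p,q})\colon M_{pq}\to M_p\times_{s_p,X,r_q}M_q$, which are the canonical ones if $p=1$ or $q=1$ and which satisfy the associativity conditions $r_{p,q}\circ r_{pq,t}=r_{p,qt}$, $s_{p,q}\circ r_{pq,t}=r_{q,t}\circ s_{p,qt}$ and $s_{pq,t}=s_{q,t}\circ s_{p,qt}$ for all $p,q,t\in P$. Let $H^0=\{(m_p)_{p\in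 P}\in\prod_{p} M_p\mid r_{p,q}(m_{pq})=m_p \text{ for all } p,q\in P\}$ with the subspace topology, let $\pi_1\colon H^0\to M_1=X$ be the projection $(m_p)_p\mapsto m_1$, and let $\tilde s_t\colon H^0\to H^0$, $(m_p)_p\mapsto (s_{t,p}(m_{tp}))_p$, for $t\in P$. Let $H$ be the étale groupoid with object space $H^0$ and arrow space $$H^1=\{(x,g,y)\in H^0\times G\times H^0\mid \exists\, p_1,p_2\in P:\ g=p_1p_2^{-1},\ \tilde s_{p_1}(x)=\tilde s_{p_2}(y)\},$$ with range $r(x,g,y)=x$ and source $s(x,g,y)=y$; its topology is the quotient topology from the disjoint union over $p_1,p_2\in P$ of the spaces $\{(x,y)\mid \tilde s_{p_1}(x)=\tilde s_{p_2}(y)\}\subseteq H^0\times H^0$ under $(x,y)\mapsto(x,p_1p_2^{-1},y)$. Put $H^1_g=\{(x,g,y)\in H^1\}$ for $g\in G$. A bisection is an open subset of $H^1$ on which $r$ and $s$ are injective. Let $c\colon P\to(0,\infty)$ be a homomorphism to the multiplicative group of positive reals, extended to $G$ by $c(pq^{-1})=c(p)/c(q)$. "Measure" means (positive) Radon measure.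 A measure $\mu$ on $H^0$ is called $c$-invariant if $\mu(r(B))=c(g)\,\mu(s(B))$ for all $g\in G$ and all bisections $B\subseteq H^1_g$. A measure $\lambda$ on $X$ is called $c$-invariant if $\lambda=c(p)\,(r_p)_*s_p^*\lambda$ for all $p\in P$; here $(r_p)_*$ is the push-forward of measures and $s_p^*\lambda$ is the measure $B\mapsto\int_X|s_p^{-1}(x)\cap B|\,d\lambda(x)$ on the Borel subsets of $M_p$. **Theorem.** The map $\mu\mapsto(\pi_1)_*\mu$ is a bijection from the set of $c$-invariant measures on $H^0$ onto the set of $c$-invariant measures on $X$. -/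

import Mathlib

open Set MeasureTheory TopologicalSpace

universe u v w

noncomputable section

/-! ### Right Ore monoids and their groups of fractions -/

/-- A right Ore monoid. -/
class RightOreMonoid (P : Type w) [Monoid P] : Prop where
  exists_mul_eq : ∀ x₁ x₂ : P, ∃ y₁ y₂ : P, x₁ * y₁ = x₂ * y₂
  exists_mul_eq_of_mul_eq : ∀ x y₁ y₂ : P, x * y₁ = x * y₂ → ∃ z : P, y₁ * z = y₂ * z

/-- Two formal quotients `p₁ q₁⁻¹` and `p₂ q₂⁻¹` are equivalent if
`(p₁ t₁, q₁ t₁) = (p₂ t₂, q₂ t₂)` for some `t₁, t₂`. -/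
def fracSetoid (P : Type w) [Monoid P] [RightOreMonoid P] : Setoid (P × P) where
  r a b := ∃ t₁ t₂ : P, a.1 * t₁ = b.1 * t₂ ∧ a.2 * t₁ = b.2 * t₂
  iseqv :=
    { refl := fun _ => ⟨1, 1, rfl, rfl⟩
      symm := fun ⟨t₁, t₂, h₁, h₂⟩ => ⟨t₂, t₁, h₁.symm, h₂.symm⟩
      trans := by
        rintro a b d ⟨t₁, t₂, h₁, h₂⟩ ⟨u₁, u₂, k₁, k₂⟩
        obtain ⟨y, z, hyz⟩ := RightOreMonoid.exists_mul_eq t₂ u₁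
        refine ⟨t₁ * y, u₂ * z, ?_, ?_⟩
        · rw [← mul_assoc, h₁, mul_assoc, hyz, ← mul_assoc, k₁, mul_assoc]
        · rw [← mul_assoc, h₂, mul_assoc, hyz, ← mul_assoc, k₂, mul_assoc] }

/-- The underlying set of the group completion `G` of a right Ore monoid `P`: classes of formal
quotients `p q⁻¹`. -/
def FracGroup (P : Type w) [Monoid P] [RightOreMonoid P] : Type w := Quotient (fracSetoid P)

/-- The element `p q⁻¹` of `G`. -/
def FracGroup.mk {P : Type w} [Monoid P] [RightOreMonoid P] (p q : P) : FracGroup P :=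
  Quotient.mk (fracSetoid P) (p, q)

/-- The extension of a homomorphism `c : P → (0,∞)` to `G`, `c (p q⁻¹) = c p / c q`. -/
def FracGroup.extend {P : Type w} [Monoid P] [RightOreMonoid P]
    (c : P →* {x : ℝ // 0 < x}) : FracGroup P → {x : ℝ // 0 < x} :=
  Quotient.lift (fun a : P × P => c a.1 / c a.2) (by
    rintro a b ⟨t₁, t₂, h₁, h₂⟩
    have e₁ : c a.1 * c t₁ = c b.1 * c t₂ := by rw [← map_mul, h₁, map_mul]
    have e₂ : c a.2 * c t₁ = c b.2 * c t₂ := by rw [← map_mul, h₂, map_mul]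
    calc c a.1 / c a.2 = (c a.1 * c t₁) / (c a.2 * c t₁) := (mul_div_mul_right_eq_div _ _ _).symm
      _ = (c b.1 * c t₂) / (c b.2 * c t₂) := by rw [e₁, e₂]
      _ = c b.1 / c b.2 := mul_div_mul_right_eq_div _ _ _)

/-! ### Actions by proper topological correspondences -/

/-- An action of the monoid `P` on the space `X` by proper topological correspondences
`X ← M p → X`, with `r p` proper and `s p` a local homeomorphism, and with homeomorphisms
`M (p q) ≃ M p ×_{s, X, r} M q`. The latter are indexed by the equations `p * q = t`, so that
the unit and associativity conditions need no transport along equalities in `P`.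

The identification of `M 1` with `X` is given by the homeomorphism `r 1 = s 1`. The missing
components of the two unit conditions (`s p` and `r q`) follow from the fibre product
condition. -/
structure ProperCorrAction (P : Type w) [Monoid P] (X : Type u) [TopologicalSpace X]
    (M : P → Type v) [∀ p, TopologicalSpace (M p)] where
  r : ∀ p, M p → X
  s : ∀ p, M p → X
  isProperMap_r : ∀ p, IsProperMap (r p)
  isLocalHomeomorph_s : ∀ p, IsLocalHomeomorph (s p)
  σ : ∀ {p q t : P}, p * q = t → M t ≃ₜ {x : M p × M q // s p x.1 = r q x.2}
  s_one : s 1 = r 1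
  isHomeomorph_one : IsHomeomorph (r 1)
  σ_mul_one : ∀ (p : P) (m : M p), (σ (mul_one p) m).1.1 = m
  σ_one_mul : ∀ (q : P) (m : M q), (σ (one_mul q) m).1.2 = m
  /-- Cutting a story of length `p q t` into three pieces gives the same result both ways. -/
  assoc : ∀ {p q t a b d : P} (hpq : p * q = a) (hat : a * t = d) (hqt : q * t = b)
    (hpb : p * b = d) (m : M d),
    (σ hpq (σ hat m).1.1).1.1 = (σ hpb m).1.1 ∧
    (σ hpq (σ hat m).1.1).1.2 = (σ hqt (σ hpb m).1.2).1.1 ∧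
    (σ hat m).1.2 = (σ hqt (σ hpb m).1.2).1.2

namespace ProperCorrAction

variable {P : Type w} [Monoid P] {X : Type u} [TopologicalSpace X]
  {M : P → Type v} [∀ p, TopologicalSpace (M p)] (A : ProperCorrAction P X M)

/-- The map `r_{p,q} : M (p q) → M p`. -/
def rr {p q t : P} (h : p * q = t) (m : M t) : M p := (A.σ h m).1.1

/-- The map `s_{p,q} : M (p q) → M q`. -/
def ss {p q t : P} (h : p * q = t) (m : M t) : M q := (A.σ h m).1.2

/-- The space `H⁰` of complete histories: the limit of the spaces `M p` along the maps
`r_{p,q}`, with the subspace topology from the product. -/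
def H0 : Type (max v w) :=
  {m : ∀ p, M p // ∀ p q : P, A.rr (rfl : p * q = p * q) (m (p * q)) = m p}

instance : TopologicalSpace A.H0 := inferInstanceAs (TopologicalSpace (Subtype _))

instance : MeasurableSpace A.H0 := borel A.H0

instance : BorelSpace A.H0 := ⟨rfl⟩

/-- The projection `π₁ : H⁰ → M 1 ≅ X`. -/
def π₁ (m : A.H0) : X := A.r 1 (m.1 1)

/-- The map `s̃_t : H⁰ → H⁰`, `(m_p)_p ↦ (s_{t,p} (m_{t p}))_p`, forgetting the last time
period of length `t`. -/
def shift (t : P) (m : A.H0) : A.H0 :=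
  ⟨fun p => A.ss (rfl : t * p = t * p) (m.1 (t * p)), fun p q => by
    have key : ∀ {a : P} (h : t * p * q = a), A.rr h (m.1 a) = m.1 (t * p) := by
      rintro a rfl
      exact m.2 _ _
    have h := (A.assoc (rfl : t * p = t * p) (mul_assoc t p q) (rfl : p * q = p * q) rfl
      (m.1 (t * (p * q)))).2.1
    have k : (A.σ (mul_assoc t p q) (m.1 (t * (p * q)))).1.1 = m.1 (t * p) := key _
    rw [k] at h
    exact h.symm⟩

variable [RightOreMonoid P]

/-- The arrow space `H¹` of the transformation groupoid `H = Pᵒᵖ ⋉ H⁰`: triples `(x, g, y)`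
such that `g = p₁ p₂⁻¹` and `s̃_{p₁} x = s̃_{p₂} y` for some `p₁, p₂`. -/
def H1 : Type (max v w) :=
  {a : A.H0 × FracGroup P × A.H0 // ∃ p₁ p₂ : P, a.2.1 = FracGroup.mk p₁ p₂ ∧
    A.shift p₁ a.1 = A.shift p₂ a.2.2}

/-- The range map `r (x, g, y) = x`. -/
def range (a : A.H1) : A.H0 := a.1.1

/-- The degree `g` of `(x, g, y)`; the fibre over `g` is `H¹_g`. -/
def degree (a : A.H1) : FracGroup P := a.1.2.1

/-- The source map `s (x, g, y) = y`. -/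
def source (a : A.H1) : A.H0 := a.1.2.2

/-- The fibre product `H¹_{p₁,p₂}`, with the subspace topology from `H⁰ × H⁰`. -/
abbrev H1Piece (p₁ p₂ : P) : Type (max v w) :=
  {z : A.H0 × A.H0 // A.shift p₁ z.1 = A.shift p₂ z.2}

/-- The canonical surjection from the disjoint union of the `H¹_{p₁,p₂}` onto `H¹`. -/
def fromPieces (z : Σ i : P × P, A.H1Piece i.1 i.2) : A.H1 :=
  ⟨(z.2.1.1, FracGroup.mk z.1.1 z.1.2, z.2.1.2), z.1.1, z.1.2, rfl, z.2.2⟩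

/-- `H¹` carries the quotient topology from the disjoint union of the `H¹_{p₁,p₂}`. -/
instance : TopologicalSpace A.H1 := TopologicalSpace.coinduced A.fromPieces inferInstance

/-- A bisection of the étale groupoid `H`: an open set of arrows on which range and source
are injective. -/
def IsBisection (B : Set A.H1) : Prop :=
  IsOpen B ∧ InjOn A.range B ∧ InjOn A.source B

/-- `c`-invariance of a measure on `H⁰`: `μ (r(B)) = c(g) μ (s(B))` for each bisection
`B ⊆ H¹_g`. -/
def IsInvariantH0 (c : P →* {x : ℝ // 0 < x}) (μ : Measure A.H0) : Prop :=
  ∀ (g : FracGroup P) (B : Set A.H1), A.IsBisection B → (∀ b ∈ B, A.degree b = g) →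
    μ (A.range '' B) = ENNReal.ofReal (FracGroup.extend c g : ℝ) * μ (A.source '' B)

end ProperCorrAction

/-! ### Pull-back of measures along local homeomorphisms -/

section pullback

variable {M : Type v} {X : Type u}

/-- The pull-back `f^* ν` of a measure along a local homeomorphism: the integral against `ν` of
the counting measures on the fibres of `f`. The lemma `pullback_apply` below computes it. -/
def pullback [MeasurableSpace M] [MeasurableSpace X] (f : M → X) (ν : Measure X) : Measure M :=
  ν.bind fun y => Measure.count.restrict (f ⁻¹' {y})

theorem measurable_count_fibre [TopologicalSpace M] [TopologicalSpace X] [T2Space M] [T2Space X]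
    [SecondCountableTopology M] [MeasurableSpace M] [BorelSpace M] [MeasurableSpace X]
    [BorelSpace X] {f : M → X} (hf : IsLocalHomeomorph f) :
    Measurable fun y : X => (Measure.count : Measure M).restrict (f ⁻¹' {y}) := by
  refine Measure.measurable_of_measurable_coe _ fun B hB => ?_
  rcases isEmpty_or_nonempty M with hM | hM
  · have : B = ∅ := Set.eq_empty_of_isEmpty B
    simp [this]
  choose U hU hUf using isLocalHomeomorph_iff_isOpenEmbedding_restrict.1 hf
  obtain ⟨S, hSc, hS⟩ := countable_cover_nhds (f := fun x => interior (U x))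
    (fun x => interior_mem_nhds.2 (hU x))
  have hSne : S.Nonempty := by
    by_contra h
    rw [Set.not_nonempty_iff_eq_empty] at h
    subst h
    simp only [mem_empty_iff_false, iUnion_of_empty, iUnion_empty] at hS
    have h : hM.some ∈ (∅ : Set M) := hS ▸ mem_univ hM.some
    exact h
  obtain ⟨e, he⟩ := hSc.exists_eq_range hSne
  set V : ℕ → Set M := fun n => interior (U (e n)) with hV
  have hVu : ⋃ n, V n = univ := by
    rw [← hS, he, biUnion_range]
  set D := disjointed V with hD
  have hDm : ∀ n, MeasurableSet (D n) :=
    fun n => MeasurableSet.disjointed (fun k => isOpen_interior.measurableSet) n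
  have hDu : ⋃ n, D n = univ := by rw [hD, iUnion_disjointed, hVu]
  have hinj : ∀ n, InjOn f (V n) := fun n =>
    (injOn_iff_injective.2 (hUf (e n)).injective).mono interior_subset
  have hDV : ∀ n, D n ⊆ V n := fun n => disjointed_subset V n
  have himg : ∀ n, MeasurableSet (f '' (B ∩ D n)) := by
    intro n
    have hemb : Topology.IsOpenEmbedding ((V n).domRestrict f) :=
      (hf.comp isOpen_interior.isOpenEmbedding_subtypeVal.isLocalHomeomorph)
        |>.isOpenEmbedding_of_injective (injOn_iff_injective.1 (hinj n))
    have h1 : f '' (B ∩ D n) = (V n).domRestrict f '' (Subtype.val ⁻¹' (B ∩ D n)) := by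
      rw [Set.domRestrict_eq, Set.image_comp, Subtype.image_preimage_coe,
        Set.inter_eq_right.2 (inter_subset_right.trans (hDV n))]
    rw [h1]
    exact hemb.measurableEmbedding.measurableSet_image.2
      (measurable_subtype_coe (hB.inter (hDm n)))
  have key : ∀ y, (Measure.count : Measure M).restrict (f ⁻¹' {y}) B
      = ∑' n, (f '' (B ∩ D n)).indicator 1 y := by
    intro y
    have hy : MeasurableSet (f ⁻¹' {y}) :=
      (isClosed_singleton.preimage hf.continuous).measurableSet
    rw [Measure.restrict_apply hB]
    have h2 : B ∩ f ⁻¹' {y} = ⋃ n, (B ∩ D n ∩ f ⁻¹' {y}) := by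
      rw [← iUnion_inter, ← inter_iUnion, hDu, inter_univ]
    rw [h2, measure_iUnion (fun i j hij => ((disjoint_disjointed V hij).mono
      (inter_subset_left.trans inter_subset_right) (inter_subset_left.trans inter_subset_right)))
      (fun n => (hB.inter (hDm n)).inter hy)]
    refine tsum_congr fun n => ?_
    by_cases hmem : y ∈ f '' (B ∩ D n)
    · rw [indicator_of_mem hmem]
      obtain ⟨x, hx, rfl⟩ := hmem
      have : B ∩ D n ∩ f ⁻¹' {f x} = {x} := by
        ext z
        constructor
        · rintro ⟨hz, hzx⟩
          exact hinj n (hDV n hz.2) (hDV n hx.2) hzx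
        · rintro rfl
          exact ⟨hx, rfl⟩
      rw [this]
      simp
    · rw [indicator_of_notMem hmem]
      have : B ∩ D n ∩ f ⁻¹' {y} = ∅ := by
        ext z
        simp only [mem_inter_iff, mem_preimage, mem_singleton_iff, mem_empty_iff_false, iff_false]
        rintro ⟨hz, rfl⟩
        exact hmem ⟨z, hz, rfl⟩
      rw [this]
      simp
  simp_rw [key]
  exact Measurable.tsum fun n => measurable_one.indicator (himg n)

/-- `f^* ν (B) = ∫ |f⁻¹(y) ∩ B| dν(y)`. -/
theorem pullback_apply [TopologicalSpace M] [TopologicalSpace X] [T2Space M] [T2Space X]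
    [SecondCountableTopology M] [MeasurableSpace M] [BorelSpace M] [MeasurableSpace X]
    [BorelSpace X] {f : M → X} (hf : IsLocalHomeomorph f) (ν : Measure X) {B : Set M}
    (hB : MeasurableSet B) :
    pullback f ν B = ∫⁻ y, ((f ⁻¹' {y} ∩ B).encard : ENNReal) ∂ν := by
  rw [pullback, Measure.bind_apply hB (measurable_count_fibre hf).aemeasurable]
  refine lintegral_congr fun y => ?_
  have hy : MeasurableSet (f ⁻¹' {y}) :=
    (isClosed_singleton.preimage hf.continuous).measurableSet
  rw [Measure.restrict_apply hB, Set.inter_comm, Measure.count_apply (hy.inter hB)]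

end pullback

namespace ProperCorrAction

variable {P : Type w} [Monoid P] {X : Type u} [TopologicalSpace X]
  {M : P → Type v} [∀ p, TopologicalSpace (M p)]

/-- If `X` is second countable, then so are the spaces `M p`; so `pullback_apply` applies. -/
theorem secondCountable_M (A : ProperCorrAction P X M) [T2Space X] [LocallyCompactSpace X]
    [SecondCountableTopology X] (p : P) : SecondCountableTopology (M p) := by
  have : SigmaCompactSpace (M p) := by
    refine ⟨⟨fun n => A.r p ⁻¹' compactCovering X n,
      fun n => (A.isProperMap_r p).isCompact_preimage (isCompact_compactCovering X n), ?_⟩⟩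
    rw [← preimage_iUnion, iUnion_compactCovering, preimage_univ]
  choose U hU hUf using
    isLocalHomeomorph_iff_isOpenEmbedding_restrict.1 (A.isLocalHomeomorph_s p)
  obtain ⟨S, hSc, hS⟩ := countable_cover_nhds_of_sigmaCompact (f := fun x => interior (U x))
    (fun x => interior_mem_nhds.2 (hU x))
  have : Countable S := hSc.to_subtype
  have : ∀ x : S, SecondCountableTopology (interior (U x.1) : Set (M p)) := fun x => by
    have h1 : SecondCountableTopology (U x.1) :=
      (hUf x.1).isEmbedding.secondCountableTopology
    exact (Topology.IsEmbedding.inclusion interior_subset).secondCountableTopology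
  refine secondCountableTopology_of_countable_cover (U := fun x : S => interior (U x.1))
    (fun x => isOpen_interior) ?_
  rw [← hS, biUnion_eq_iUnion]

/-- `c`-invariance of a measure on `X`: `ν = c(p) (r_p)_* s_p^* ν` for all `p`. -/
def IsInvariantX [MeasurableSpace X] [∀ p, MeasurableSpace (M p)] (A : ProperCorrAction P X M)
    (c : P →* {x : ℝ // 0 < x}) (ν : Measure X) : Prop :=
  ∀ p : P, ν = ENNReal.ofReal (c p : ℝ) • (pullback (A.s p) ν).map (A.r p)

end ProperCorrAction

end

/-! Invariance under bisections amounts to `μ = c(p) s̃_p^* μ` for all `p` (`isInvariantH0_iff`):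
locally the graph of `s̃_p` is a bisection, and every bisection splits into countably many pieces
along which `s̃_{p₁} x = s̃_{p₂} y` with both shifts injective.

A history is its first `p` steps followed by another history, so `H⁰ ≅ M p ×_X H⁰`
(`historyHomeomorph`). Push-forward and pull-back commute in this square (`map_pullback_of_bijOn`),
so the marginal of an invariant `μ` on `M p` is `c(p) s_p^* ν` with `ν = (π₁)_* μ`
(`map_proj_of_invariant`). Applying `r_p` shows that `ν` is invariant. Since `ν` determines all
marginals, and these determine `μ` by directedness, the map is injective.

Conversely, invariance of `ν` makes the measures `c(p) s_p^* ν` a projective family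
(`map_rr_pullback`), and its limit on `H⁰` is built in `exists_regular_map_proj_eq` from the content
`K ↦ inf_p ρ_p(K_p)`, where `K_p` is the image of `K` in `M p`. The maps between the `M p` need not
be surjective; no mass is lost because a compact set that misses all complete histories is already
missed at a finite stage (`exists_forall_rr_notMem`). The limit `μ` and `c(p) s̃_p^* μ` have equal
marginals on all `M (p q)`, hence agree. -/

noncomputable section

/-! ### Local homeomorphisms and pull-back of measures -/

section LocalHomeomorph

open Topology

/-- Base change of a local homeomorphism `f` along a continuous map `g`. -/
theorem IsLocalHomeomorph.baseChange {M X Y : Type*} [TopologicalSpace M] [TopologicalSpace X]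
    [TopologicalSpace Y] {f : M → X} (hf : IsLocalHomeomorph f) {g : Y → X} (hg : Continuous g) :
    IsLocalHomeomorph (fun x : {x : M × Y // f x.1 = g x.2} => x.1.2) := by
  have hopen : IsOpenMap (fun x : {x : M × Y // f x.1 = g x.2} => x.1.2) := by
    intro W hW
    rw [isOpen_iff_mem_nhds]
    rintro _ ⟨⟨⟨m, y⟩, hmy⟩, hxW, rfl⟩
    obtain ⟨W', hW', rfl⟩ := isOpen_induced_iff.1 hW
    obtain ⟨U, V, hU, hV, hmU, hyV, hUV⟩ := isOpen_prod_iff.1 hW' m y hxW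
    have hfU : IsOpen (g ⁻¹' (f '' U)) := (hf.isOpenMap U hU).preimage hg
    filter_upwards [hV.mem_nhds hyV, hfU.mem_nhds ⟨m, hmU, hmy⟩]
    rintro y' hy' ⟨m', hm', h⟩
    exact ⟨⟨(m', y'), h⟩, hUV ⟨hm', hy'⟩, rfl⟩
  rw [isLocalHomeomorph_iff_isOpenEmbedding_restrict]
  rintro ⟨⟨m, y⟩, hmy⟩
  obtain ⟨U, hU, hmU, hinj⟩ := hf.isLocallyInjective m
  have hU' : IsOpen {x : {x : M × Y // f x.1 = g x.2} | x.1.1 ∈ U} :=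
    hU.preimage (continuous_fst.comp continuous_subtype_val)
  refine ⟨_, hU'.mem_nhds hmU, .of_continuous_injective_isOpenMap ?_ ?_ ?_⟩
  · exact (continuous_snd.comp continuous_subtype_val).comp continuous_subtype_val
  · rintro ⟨⟨⟨m₁, y₁⟩, h₁⟩, k₁⟩ ⟨⟨⟨m₂, y₂⟩, h₂⟩, k₂⟩ (h : y₁ = y₂)
    subst h
    have : m₁ = m₂ := hinj k₁ k₂ (h₁.trans h₂.symm)
    subst this
    rfl
  · exact hopen.domRestrict hU'

theorem IsLocalHomeomorph.exists_isOpen_injOn_lt_top {M : Type v} {X : Type u} [TopologicalSpace M]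
    [TopologicalSpace X] [MeasurableSpace X] {f : M → X} (hf : IsLocalHomeomorph f)
    (ν : Measure X) [IsLocallyFiniteMeasure ν] (x : M) {W : Set M} (hW : W ∈ 𝓝 x) :
    ∃ U ⊆ W, IsOpen U ∧ x ∈ U ∧ InjOn f U ∧ ν (f '' U) < ⊤ := by
  obtain ⟨U, hU, hxU, hinj⟩ := hf.isLocallyInjective x
  obtain ⟨V, hxV, hV, hVt⟩ := ν.exists_isOpen_measure_lt_top (f x)
  have hmem : W ∩ (U ∩ f ⁻¹' V) ∈ 𝓝 x := Filter.inter_mem hW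
    ((hU.inter (hV.preimage hf.continuous)).mem_nhds ⟨hxU, hxV⟩)
  obtain ⟨T, hT, hTo, hxT⟩ := mem_nhds_iff.1 hmem
  refine ⟨T, hT.trans inter_subset_left, hTo, hxT, hinj.mono fun _ h => (hT h).2.1,
    (measure_mono ?_).trans_lt hVt⟩
  rintro _ ⟨z, hz, rfl⟩
  exact (hT hz).2.2

theorem pullback_smul {M : Type v} {X : Type u} [MeasurableSpace M] [MeasurableSpace X]
    (f : M → X) (a : ENNReal) (ν : Measure X) :
    pullback f (a • ν) = a • pullback f ν := by
  simp [pullback, Measure.bind, Measure.join_smul, Measure.map_smul]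

variable {M : Type v} {X : Type u} [TopologicalSpace M] [TopologicalSpace X]
  [SecondCountableTopology M] {f : M → X}

theorem IsLocalHomeomorph.exists_countable_cover_injOn (hf : IsLocalHomeomorph f) :
    ∃ S : Set (Set M), S.Countable ∧ (∀ U ∈ S, IsOpen U ∧ InjOn f U) ∧ ⋃₀ S = univ := by
  choose U hU hxU hinj using hf.isLocallyInjective
  obtain ⟨S, hSc, hS⟩ := countable_cover_nhds (f := U) (fun x => (hU x).mem_nhds (hxU x))
  refine ⟨U '' S, hSc.image U, ?_, by rwa [sUnion_image]⟩
  rintro _ ⟨x, -, rfl⟩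
  exact ⟨hU x, hinj x⟩

variable [MeasurableSpace M] [BorelSpace M] [MeasurableSpace X] [BorelSpace X]

theorem IsLocalHomeomorph.measurableSet_image (hf : IsLocalHomeomorph f) {B : Set M}
    (hB : MeasurableSet B) : MeasurableSet (f '' B) := by
  obtain ⟨S, hSc, hS, hSu⟩ := hf.exists_countable_cover_injOn
  have : f '' B = ⋃ U ∈ S, f '' (B ∩ U) := by
    rw [← image_iUnion₂, ← inter_iUnion₂, ← sUnion_eq_biUnion, hSu, inter_univ]
  rw [this]
  refine .biUnion hSc fun U hU => ?_
  have hemb : IsOpenEmbedding (U.domRestrict f) :=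
    (hf.comp (hS U hU).1.isOpenEmbedding_subtypeVal.isLocalHomeomorph)
      |>.isOpenEmbedding_of_injective (injOn_iff_injective.1 (hS U hU).2)
  have h1 : f '' (B ∩ U) = U.domRestrict f '' (Subtype.val ⁻¹' B) := by
    rw [Set.domRestrict_eq, Set.image_comp, Subtype.image_preimage_coe, inter_comm]
  rw [h1]
  exact hemb.measurableEmbedding.measurableSet_image.2 (measurable_subtype_coe hB)

variable [T2Space M] [T2Space X]

theorem pullback_apply_of_injOn (hf : IsLocalHomeomorph f) (ν : Measure X) {B : Set M}
    (hB : MeasurableSet B) (hinj : InjOn f B) : pullback f ν B = ν (f '' B) := by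
  rw [pullback_apply hf ν hB, ← lintegral_indicator_one (hf.measurableSet_image hB)]
  refine lintegral_congr fun y => ?_
  by_cases hy : y ∈ f '' B
  · rw [indicator_of_mem hy]
    obtain ⟨x, hx, rfl⟩ := hy
    have : f ⁻¹' {f x} ∩ B = {x} := by
      ext z
      constructor
      · rintro ⟨hz, hzB⟩
        exact hinj hzB hx hz
      · rintro rfl
        exact ⟨rfl, hx⟩
    simp [this]
  · rw [indicator_of_notMem hy]
    have : f ⁻¹' {y} ∩ B = ∅ := by
      ext z
      simp only [mem_inter_iff, mem_preimage, mem_singleton_iff, mem_empty_iff_false, iff_false]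
      rintro ⟨rfl, hz⟩
      exact hy ⟨z, hz, rfl⟩
    simp [this]

theorem isLocallyFiniteMeasure_pullback (hf : IsLocalHomeomorph f) (ν : Measure X)
    [IsLocallyFiniteMeasure ν] : IsLocallyFiniteMeasure (pullback f ν) := by
  refine ⟨fun x => ?_⟩
  obtain ⟨U, -, hU, hxU, hinj, hlt⟩ := hf.exists_isOpen_injOn_lt_top ν x Filter.univ_mem
  exact ⟨U, hU.mem_nhds hxU, by rwa [pullback_apply_of_injOn hf ν hU.measurableSet hinj]⟩

/-- The open sets on which `f` is injective with image of finite measure form a basis closed under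
intersections, and countably many of them cover `M`. So the values on these sets determine the
measure. -/
theorem eq_pullback_of_isOpen (hf : IsLocalHomeomorph f) (ν : Measure X)
    [IsLocallyFiniteMeasure ν] {ρ : Measure M}
    (h : ∀ U, IsOpen U → InjOn f U → ρ U = ν (f '' U)) : ρ = pullback f ν := by
  let S : Set (Set M) := {U | IsOpen U ∧ InjOn f U ∧ ν (f '' U) < ⊤}
  have hbasis : IsTopologicalBasis S := by
    refine isTopologicalBasis_of_isOpen_of_nhds (fun U hU => hU.1) fun x W hx hW => ?_
    obtain ⟨U, hUW, hU, hxU, h⟩ := hf.exists_isOpen_injOn_lt_top ν x (hW.mem_nhds hx)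
    exact ⟨U, ⟨hU, h⟩, hxU, hUW⟩
  choose U _ hU hxU hinj hlt using
    fun x => hf.exists_isOpen_injOn_lt_top ν x Filter.univ_mem
  obtain ⟨T, hTc, hT⟩ := countable_cover_nhds (f := U) (fun x => (hU x).mem_nhds (hxU x))
  refine Measure.ext_of_generateFrom_of_cover_subset (S := S) (T := U '' T)
    (hbasis.borel_eq_generateFrom ▸ BorelSpace.measurable_eq) ?_ ?_ (hTc.image U)
    (by rwa [sUnion_image]) ?_ ?_
  · rintro A hA B hB -
    exact ⟨hA.1.inter hB.1, hA.2.1.mono inter_subset_left,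
      (measure_mono (image_mono inter_subset_left)).trans_lt hA.2.2⟩
  · rintro _ ⟨x, -, rfl⟩
    exact ⟨hU x, hinj x, hlt x⟩
  · rintro _ ⟨x, -, rfl⟩
    rw [h _ (hU x) (hinj x)]
    exact (hlt x).ne
  · rintro A hA
    rw [h _ hA.1 hA.2.1, pullback_apply_of_injOn hf ν hA.1.measurableSet hA.2.1]

theorem pullback_pullback {Z : Type*} [TopologicalSpace Z] [T2Space Z] [MeasurableSpace Z]
    [BorelSpace Z] [SecondCountableTopology X] {g : X → Z} (hf : IsLocalHomeomorph f)
    (hg : IsLocalHomeomorph g) (ν : Measure Z) [IsLocallyFiniteMeasure ν] :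
    pullback f (pullback g ν) = pullback (g ∘ f) ν := by
  refine eq_pullback_of_isOpen (hg.comp hf) ν fun U hU hinj => ?_
  rw [pullback_apply_of_injOn hf _ hU.measurableSet fun x hx y hy h => hinj hx hy (congrArg g h),
    pullback_apply_of_injOn hg _ (hf.isOpenMap U hU).measurableSet, image_comp]
  rintro _ ⟨x, hx, rfl⟩ _ ⟨y, hy, rfl⟩ h
  exact congrArg f (hinj hx hy h)

/-- Compatibility of push-forward and pull-back in a square which restricts to bijections between
the fibres of the local homeomorphisms. -/
theorem map_pullback_of_bijOn {M' X' : Type*} [TopologicalSpace M'] [TopologicalSpace X']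
    [SecondCountableTopology M'] [MeasurableSpace M'] [BorelSpace M'] [MeasurableSpace X']
    [BorelSpace X'] [T2Space M'] [T2Space X'] {f' : M' → X'} {a : M' → M} {b : X' → X}
    (hf : IsLocalHomeomorph f) (hf' : IsLocalHomeomorph f') (ha : Measurable a)
    (hb : Measurable b) (hab : ∀ y, BijOn a (f' ⁻¹' {y}) (f ⁻¹' {b y})) (ν : Measure X') :
    (pullback f' ν).map a = pullback f (ν.map b) := by
  ext B hB
  have hm : Measurable fun y => ((f ⁻¹' {y} ∩ B).encard : ENNReal) := by
    have h := (Measure.measurable_coe hB).comp (measurable_count_fibre hf)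
    convert h using 2 with y
    have hy : MeasurableSet (f ⁻¹' {y}) :=
      (isClosed_singleton.preimage hf.continuous).measurableSet
    rw [Function.comp_apply, Measure.restrict_apply hB, inter_comm,
      Measure.count_apply (hB.inter hy)]
  rw [Measure.map_apply ha hB, pullback_apply hf' ν (ha hB), pullback_apply hf _ hB,
    lintegral_map hm hb]
  refine lintegral_congr fun y => ?_
  have : f ⁻¹' {b y} ∩ B = a '' (f' ⁻¹' {y} ∩ a ⁻¹' B) := by
    rw [image_inter_preimage, (hab y).image_eq]
  rw [this, ((hab y).injOn.mono inter_subset_left).encard_image]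

end LocalHomeomorph

/-! ### Filteredness of an Ore monoid -/

namespace RightOreMonoid

variable {P : Type w} [Monoid P] [RightOreMonoid P]

/-- A finite part of the category with objects `P` and arrows `b : a → a * b` has a cocone. -/
theorem exists_cocone (O : Finset P) (S : Finset (P × P)) :
    ∃ (t : P) (f : P → P), (∀ a ∈ O, a * f a = t) ∧
      ∀ i ∈ S, i.1 ∈ O → i.1 * i.2 ∈ O → f i.1 = i.2 * f (i.1 * i.2) := by
  classical
  induction S using Finset.induction_on with
  | empty =>
    induction O using Finset.induction_on with
    | empty => exact ⟨1, id, by simp, by simp⟩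
    | insert a O ha ih =>
      obtain ⟨t, f, hf, -⟩ := ih
      obtain ⟨y, z, hyz⟩ := exists_mul_eq a t
      refine ⟨t * z, fun b => if b = a then y else f b * z, fun b hb => ?_, by simp⟩
      dsimp only
      split_ifs with h
      · rw [h, hyz]
      · rw [← mul_assoc, hf b ((Finset.mem_insert.1 hb).resolve_left h)]
  | insert i S hi ih =>
    obtain ⟨t, f, hf, hS⟩ := ih
    by_cases h : i.1 ∈ O ∧ i.1 * i.2 ∈ O
    -- Both legs give `t` after left multiplication by `i.1`, so some `z` equalises them. Extending
    -- all legs by `z` preserves the earlier relations.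
    · obtain ⟨z, hz⟩ := exists_mul_eq_of_mul_eq i.1 (f i.1) (i.2 * f (i.1 * i.2))
        (by rw [hf _ h.1, ← mul_assoc, hf _ h.2])
      refine ⟨t * z, fun a => f a * z, fun a ha => by rw [← mul_assoc, hf a ha], ?_⟩
      intro j hj h1 h2
      rcases Finset.mem_insert.1 hj with rfl | hj
      · exact hz.trans (mul_assoc _ _ _)
      · dsimp only
        rw [hS j hj h1 h2, mul_assoc]
    · refine ⟨t, f, hf, fun j hj h1 h2 => ?_⟩
      rcases Finset.mem_insert.1 hj with rfl | hj
      · exact absurd ⟨h1, h2⟩ h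
      · exact hS j hj h1 h2

end RightOreMonoid

/-! ### Structure maps of the action and complete histories -/

namespace ProperCorrAction

variable {P : Type w} [Monoid P] {X : Type u} [TopologicalSpace X]
  {M : P → Type v} [∀ p, TopologicalSpace (M p)] (A : ProperCorrAction P X M)

section Structure

variable {p q t a b d : P}

theorem continuous_rr (h : p * q = t) : Continuous (A.rr h) :=
  continuous_fst.comp (continuous_subtype_val.comp (A.σ h).continuous)

theorem continuous_ss (h : p * q = t) : Continuous (A.ss h) :=
  continuous_snd.comp (continuous_subtype_val.comp (A.σ h).continuous)

theorem s_rr (h : p * q = t) (m : M t) : A.s p (A.rr h m) = A.r q (A.ss h m) := (A.σ h m).2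

theorem rr_one (h : p * 1 = p) (m : M p) : A.rr h m = m := A.σ_mul_one p m

theorem ss_one (h : 1 * p = p) (m : M p) : A.ss h m = m := A.σ_one_mul p m

theorem rr_rr (hpq : p * q = a) (hat : a * t = d) (hqt : q * t = b) (hpb : p * b = d) (m : M d) :
    A.rr hpq (A.rr hat m) = A.rr hpb m := (A.assoc hpq hat hqt hpb m).1

theorem ss_rr (hpq : p * q = a) (hat : a * t = d) (hqt : q * t = b) (hpb : p * b = d) (m : M d) :
    A.ss hpq (A.rr hat m) = A.rr hqt (A.ss hpb m) := (A.assoc hpq hat hqt hpb m).2.1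

theorem ss_ss (hpq : p * q = a) (hat : a * t = d) (hqt : q * t = b) (hpb : p * b = d) (m : M d) :
    A.ss hqt (A.ss hpb m) = A.ss hat m := (A.assoc hpq hat hqt hpb m).2.2.symm

/-- The fibre product condition for `1 * p = p` expresses `r p` as `s 1` after the restriction to `M
1`, and restrictions compose. -/
theorem r_rr (h : p * q = t) (m : M t) : A.r p (A.rr h m) = A.r t m := by
  have h1 := A.s_rr (one_mul p) (A.rr h m)
  have h2 := A.s_rr (one_mul t) m
  rw [ss_one] at h1 h2
  rw [← h1, ← h2, A.rr_rr (one_mul p) h h (one_mul t)]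

theorem s_ss (h : p * q = t) (m : M t) : A.s q (A.ss h m) = A.s t m := by
  have h1 := A.s_rr (mul_one q) (A.ss h m)
  have h2 := A.s_rr (mul_one t) m
  rw [rr_one] at h1 h2
  rw [h1, h2, A.ss_ss h (mul_one t) (mul_one q) h]

theorem ext_rr_ss (h : p * q = t) {m m' : M t} (h1 : A.rr h m = A.rr h m')
    (h2 : A.ss h m = A.ss h m') : m = m' :=
  (A.σ h).injective (Subtype.ext (Prod.ext h1 h2))

/-- The point of `M (p q)` with given components in `M p` and `M q`. -/
def glue (h : p * q = t) (x : {x : M p × M q // A.s p x.1 = A.r q x.2}) : M t := (A.σ h).symm x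

theorem continuous_glue (h : p * q = t) : Continuous (A.glue h) := (A.σ h).symm.continuous

theorem rr_glue (h : p * q = t) (x) : A.rr h (A.glue h x) = x.1.1 := by
  simp [rr, glue]

theorem ss_glue (h : p * q = t) (x) : A.ss h (A.glue h x) = x.1.2 := by
  simp [ss, glue]

theorem isProperMap_rr [T2Space X] [∀ p, T2Space (M p)] (h : p * q = t) :
    IsProperMap (A.rr h) := by
  refine isProperMap_of_comp_of_t2 (A.continuous_rr h) (A.isProperMap_r p).continuous ?_
  convert A.isProperMap_r t using 1
  exact funext (A.r_rr h)

theorem isLocalHomeomorph_ss (h : p * q = t) : IsLocalHomeomorph (A.ss h) :=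
  ((A.isLocalHomeomorph_s p).baseChange (A.isProperMap_r q).continuous).comp
    (A.σ h).isLocalHomeomorph

theorem bijOn_rr (h : p * q = t) (y : M q) :
    BijOn (A.rr h) (A.ss h ⁻¹' {y}) (A.s p ⁻¹' {A.r q y}) := by
  refine ⟨?_, ?_, ?_⟩
  · rintro m rfl
    exact A.s_rr h m
  · rintro m rfl m' hm' hmm'
    exact A.ext_rr_ss h hmm' hm'.symm
  · intro u hu
    exact ⟨A.glue h ⟨(u, y), hu⟩, A.ss_glue h _, A.rr_glue h _⟩

end Structure

section Histories

theorem H0_ext {m m' : A.H0} (h : ∀ p, m.1 p = m'.1 p) : m = m' := Subtype.ext (funext h)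

theorem continuous_proj (p : P) : Continuous fun m : A.H0 => m.1 p :=
  (continuous_apply p).comp continuous_subtype_val

theorem rr_proj {p q t : P} (h : p * q = t) (m : A.H0) : A.rr h (m.1 t) = m.1 p := by
  subst h
  exact m.2 p q

theorem r_proj (p : P) (m : A.H0) : A.r p (m.1 p) = A.π₁ m := by
  rw [π₁, ← A.rr_proj (one_mul p) m, r_rr]

theorem s_proj (p : P) (m : A.H0) : A.s p (m.1 p) = A.π₁ (A.shift p m) := by
  change _ = A.r 1 (A.ss rfl (m.1 (p * 1)))
  rw [← A.s_rr, rr_proj]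

theorem continuous_π₁ : Continuous A.π₁ :=
  (A.isProperMap_r 1).continuous.comp (A.continuous_proj 1)

theorem continuous_shift (t : P) : Continuous (A.shift t) :=
  Continuous.subtype_mk (continuous_pi fun p =>
    (A.continuous_ss rfl).comp (A.continuous_proj (t * p))) _

theorem shift_shift {p q t : P} (h : p * q = t) (m : A.H0) :
    A.shift q (A.shift p m) = A.shift t m := by
  subst h
  refine A.H0_ext fun a => ?_
  have key : ∀ {d : P} (h : p * q * a = d) (k : p * (q * a) = d),
      A.ss k (m.1 d) = A.ss rfl (m.1 (p * (q * a))) := by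
    rintro _ h rfl
    rfl
  have key' : ∀ {d : P} (h : p * q * a = d), A.ss h (m.1 d) = A.ss rfl (m.1 (p * q * a)) := by
    rintro _ rfl
    rfl
  change A.ss rfl (A.ss rfl (m.1 (p * (q * a)))) = A.ss rfl (m.1 (p * q * a))
  rw [A.ss_ss rfl (mul_assoc p q a) rfl rfl, key' (mul_assoc p q a)]

variable [RightOreMonoid P]

section Extension

variable {A} {p : P} {x : ∀ q, M (p * q)}

/-- Pass to a common multiple of `q` and `q'`. The two resulting factorisations through `a` agree
after a further factor `z`, by the cancellation axiom, and then both sides are restrictions of one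
element. Thus a family indexed by the cofinal set `p P` extends unambiguously to all of `P`. -/
theorem rr_eq_rr_of_compatible (hx : ∀ q d, A.rr (mul_assoc p q d) (x (q * d)) = x q)
    {a b b' q q' : P} (h : a * b = p * q) (h' : a * b' = p * q') :
    A.rr h (x q) = A.rr h' (x q') := by
  have hx' : ∀ {q d e : P} (k : q * d = e) (l : p * q * d = p * e), A.rr l (x e) = x q := by
    rintro q d _ rfl l
    exact hx q d
  obtain ⟨y, y', hy⟩ := RightOreMonoid.exists_mul_eq q q'
  obtain ⟨z, hz⟩ := RightOreMonoid.exists_mul_eq_of_mul_eq a (b * y) (b' * y') (by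
    rw [← mul_assoc, h, ← mul_assoc, h', mul_assoc, hy, mul_assoc])
  have e1 : q * (y * z) = q * y * z := (mul_assoc _ _ _).symm
  have e2 : q' * (y' * z) = q * y * z := by rw [hy, mul_assoc]
  have l1 : p * q * (y * z) = p * (q * y * z) := by rw [← e1, mul_assoc]
  have l2 : p * q' * (y' * z) = p * (q * y * z) := by rw [← e2, mul_assoc]
  have l3 : a * (b * y * z) = p * (q * y * z) := by
    rw [mul_assoc b, ← mul_assoc a, h, l1]
  rw [← hx' e1 l1, ← hx' e2 l2, A.rr_rr h l1 (mul_assoc _ _ _).symm l3,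
    A.rr_rr h' l2 (by rw [hz, mul_assoc]) l3]

variable (A x)

/-- The history extending a compatible family in the spaces `M (p q)`. -/
def extendHistory (hx : ∀ q d, A.rr (mul_assoc p q d) (x (q * d)) = x q) : A.H0 :=
  ⟨fun a => A.rr (RightOreMonoid.exists_mul_eq a p).choose_spec.choose_spec
      (x (RightOreMonoid.exists_mul_eq a p).choose_spec.choose), fun a b => by
    have k := (RightOreMonoid.exists_mul_eq (a * b) p).choose_spec.choose_spec
    refine (A.rr_rr rfl k rfl ((mul_assoc _ _ _).symm.trans k) _).trans ?_
    exact rr_eq_rr_of_compatible hx _ _⟩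

theorem extendHistory_apply (hx : ∀ q d, A.rr (mul_assoc p q d) (x (q * d)) = x q)
    {a b q : P} (h : a * b = p * q) : (A.extendHistory x hx).1 a = A.rr h (x q) :=
  rr_eq_rr_of_compatible hx _ _

end Extension

/-- The history beginning with `z.1 ∈ M p` and continuing with the history `z.2`. -/
def concat (p : P) (z : {z : M p × A.H0 // A.s p z.1 = A.π₁ z.2}) : A.H0 :=
  A.extendHistory
    (fun q => A.glue rfl ⟨(z.1.1, z.1.2.1 q), z.2.trans (A.r_proj q z.1.2).symm⟩) fun q d => by
      refine A.ext_rr_ss rfl ?_ ?_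
      · rw [A.rr_rr rfl _ rfl rfl, rr_glue, rr_glue]
      · rw [A.ss_rr rfl _ rfl rfl, ss_glue, ss_glue, rr_proj]

theorem concat_apply (p : P) (z : {z : M p × A.H0 // A.s p z.1 = A.π₁ z.2}) {a b q : P}
    (h : a * b = p * q) : (A.concat p z).1 a = A.rr h
      (A.glue rfl ⟨(z.1.1, z.1.2.1 q), z.2.trans (A.r_proj q z.1.2).symm⟩) :=
  A.extendHistory_apply _ _ h

/-- A history is given by its first `p` steps and the history after these. -/
def historyHomeomorph (p : P) : A.H0 ≃ₜ {z : M p × A.H0 // A.s p z.1 = A.π₁ z.2} where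
  toFun m := ⟨(m.1 p, A.shift p m), A.s_proj p m⟩
  invFun := A.concat p
  left_inv m := by
    refine A.H0_ext fun a => ?_
    obtain ⟨b, q, h⟩ := RightOreMonoid.exists_mul_eq a p
    rw [A.concat_apply p _ h, ← A.rr_proj h m]
    congr 1
    refine A.ext_rr_ss rfl ?_ ?_
    · rw [rr_glue, rr_proj]
    · rw [ss_glue]
      rfl
  right_inv z := by
    refine Subtype.ext (Prod.ext ?_ (A.H0_ext fun q => ?_))
    · exact (A.concat_apply p z (rfl : p * 1 = p * 1)).trans (A.rr_glue rfl _)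
    · refine (congrArg (A.ss rfl) (A.concat_apply p z (mul_one (p * q)))).trans ?_
      rw [rr_one, ss_glue]
  continuous_toFun :=
    ((A.continuous_proj p).prodMk (A.continuous_shift p)).subtype_mk _
  continuous_invFun := by
    refine Continuous.subtype_mk (continuous_pi fun a => (A.continuous_rr _).comp
      ((A.continuous_glue _).comp (Continuous.subtype_mk (Continuous.prodMk ?_ ?_) _))) _
    · exact continuous_fst.comp continuous_subtype_val
    · exact (A.continuous_proj _).comp (continuous_snd.comp continuous_subtype_val)

theorem isLocalHomeomorph_shift (p : P) : IsLocalHomeomorph (A.shift p) :=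
  ((A.isLocalHomeomorph_s p).baseChange A.continuous_π₁).comp
    (A.historyHomeomorph p).isLocalHomeomorph

theorem bijOn_proj (p : P) (y : A.H0) :
    BijOn (fun m : A.H0 => m.1 p) (A.shift p ⁻¹' {y}) (A.s p ⁻¹' {A.π₁ y}) := by
  refine ⟨?_, ?_, ?_⟩
  · rintro m rfl
    exact A.s_proj p m
  · rintro m rfl m' hm' hmm'
    exact (A.historyHomeomorph p).injective (Subtype.ext (Prod.ext hmm' hm'.symm))
  · intro u hu
    have h := (A.historyHomeomorph p).apply_symm_apply ⟨(u, y), hu⟩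
    exact ⟨(A.historyHomeomorph p).symm ⟨(u, y), hu⟩,
      congrArg (fun z : {z : M p × A.H0 // A.s p z.1 = A.π₁ z.2} => z.1.2) h,
      congrArg (fun z : {z : M p × A.H0 // A.s p z.1 = A.π₁ z.2} => z.1.1) h⟩

/-- Both fibres are mapped bijectively onto the same fibre of `s p`, by the restriction to `M p`, so
the comparison map between them is bijective. -/
theorem bijOn_proj_mul (p q : P) (y : A.H0) :
    BijOn (fun m : A.H0 => m.1 (p * q)) (A.shift p ⁻¹' {y})
      (A.ss (rfl : p * q = p * q) ⁻¹' {y.1 q}) := by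
  have h1 := A.bijOn_proj p y
  rw [← A.r_proj q] at h1
  have h2 : A.rr (rfl : p * q = p * q) ∘ (fun m : A.H0 => m.1 (p * q)) = fun m => m.1 p :=
    funext fun m => A.rr_proj rfl m
  rw [← h2] at h1
  have hm : MapsTo (fun m : A.H0 => m.1 (p * q)) (A.shift p ⁻¹' {y})
      (A.ss (rfl : p * q = p * q) ⁻¹' {y.1 q}) := by
    rintro m rfl
    rfl
  have h3 := A.bijOn_rr (rfl : p * q = p * q) (y.1 q)
  refine ⟨hm, h1.injOn.of_comp, fun u hu => ?_⟩
  obtain ⟨m, hmy, h⟩ := h1.surjOn (h3.mapsTo hu)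
  exact ⟨m, hmy, h3.injOn (hm hmy) hu h⟩

end Histories

/-! ### Properness and compactness of the space of histories -/

section Compactness

theorem secondCountableTopology_H0 [T2Space X] [LocallyCompactSpace X]
    [SecondCountableTopology X] [Countable P] : SecondCountableTopology A.H0 := by
  have := A.secondCountable_M
  exact (Topology.IsEmbedding.subtypeVal : Topology.IsEmbedding
    (Subtype.val : A.H0 → ∀ p, M p)).secondCountableTopology

/-- A compact set of histories of length `p` none of which extends to a complete history contains
no history that extends to length `p d`, for some `d`. -/
theorem exists_forall_rr_notMem [RightOreMonoid P] [∀ p, T2Space (M p)] {p : P}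
    {K : Set (M p)} (hK : IsCompact K)
    (h : ∀ m : A.H0, m.1 p ∉ K) : ∃ d, ∀ y : M (p * d), A.rr rfl y ∉ K := by
  classical
  by_contra! hne
  choose y hy using hne
  -- These sets supply filler values for the coordinates outside a finite part of `P`.
  have hr : ∀ a, (A.r a ⁻¹' (A.r p '' K)).Nonempty := fun a => by
    obtain ⟨b, d, hbd⟩ := RightOreMonoid.exists_mul_eq a p
    exact ⟨A.rr hbd (y d), _, hy d, by rw [r_rr, r_rr]⟩
  choose z hz using hr
  -- Compact by Tychonoff, since the `r a` are proper. Any history with `p`-component in `K` lies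
  -- here, and finitely many compatibility conditions can be met at once.
  let base : Set (∀ a, M a) := univ.pi (fun a => A.r a ⁻¹' (A.r p '' K)) ∩ {m | m p ∈ K}
  have hbase : IsCompact base :=
    (isCompact_univ_pi fun a => (A.isProperMap_r a).isCompact_preimage
      (hK.image (A.isProperMap_r p).continuous)).inter_right
      (hK.isClosed.preimage (continuous_apply p))
  obtain ⟨m, hm, hm'⟩ := hbase.inter_iInter_nonempty
    (fun i : P × P => {m | A.rr (rfl : i.1 * i.2 = i.1 * i.2) (m (i.1 * i.2)) = m i.1})
    (fun i => isClosed_eq ((A.continuous_rr _).comp (continuous_apply _)) (continuous_apply _))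
    (fun S => by
      obtain ⟨t, f, hO, hS⟩ := RightOreMonoid.exists_cocone
        (insert p (S.image Prod.fst ∪ S.image fun i => i.1 * i.2)) S
      set O := insert p (S.image Prod.fst ∪ S.image fun i => i.1 * i.2) with hOdef
      have hp : p ∈ O := Finset.mem_insert_self _ _
      have hO' : ∀ a ∈ O, a * f a = p * f p := fun a ha => (hO a ha).trans (hO p hp).symm
      -- One long history `y (f p)` is restricted to the finitely many indices in `O`; the cocone
      -- relations make these restrictions compatible along `S`.
      refine ⟨fun a => if ha : a ∈ O then A.rr (hO' a ha) (y (f p)) else z a, ⟨?_, ?_⟩, ?_⟩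
      · intro a _
        dsimp only
        split_ifs with ha
        · exact ⟨_, hy (f p), by rw [r_rr, r_rr]⟩
        · exact hz a
      · simp only [mem_ofPred_eq, hp, dif_pos]
        exact hy (f p)
      · simp only [mem_iInter]
        intro i hi
        have h1 : i.1 ∈ O := Finset.mem_insert_of_mem
          (Finset.mem_union_left _ (Finset.mem_image_of_mem _ hi))
        have h2 : i.1 * i.2 ∈ O := Finset.mem_insert_of_mem
          (Finset.mem_union_right _ (Finset.mem_image_of_mem (fun i : P × P => i.1 * i.2) hi))
        simp only [mem_ofPred_eq, h1, h2, dif_pos]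
        exact A.rr_rr rfl _ (hS i hi h1 h2).symm _ _)
  rw [mem_iInter] at hm'
  exact h ⟨m, fun a b => hm' (a, b)⟩ hm.2

variable [T2Space X] [∀ p, T2Space (M p)]

instance : T2Space A.H0 := inferInstanceAs (T2Space (Subtype _))

/-- The histories over a compact `K` form a closed subset of the product of the compact sets
`r_p⁻¹(K)`. -/
theorem isProperMap_π₁ [LocallyCompactSpace X] : IsProperMap A.π₁ := by
  rw [isProperMap_iff_isCompact_preimage]
  refine ⟨A.continuous_π₁, fun K hK => ?_⟩
  have hcl : Topology.IsClosedEmbedding (Subtype.val : A.H0 → ∀ p, M p) := by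
    have h : IsClosed {m : ∀ p, M p | ∀ p q : P, A.rr (rfl : p * q = p * q) (m (p * q)) = m p} := by
      simp only [ofPred_forall]
      exact isClosed_iInter fun p => isClosed_iInter fun q =>
        isClosed_eq ((A.continuous_rr _).comp (continuous_apply _)) (continuous_apply _)
    exact h.isClosedEmbedding_subtypeVal
  have hc := hcl.isCompact_preimage
    (isCompact_univ_pi fun p => (A.isProperMap_r p).isCompact_preimage hK)
  refine hc.of_isClosed_subset (hK.isClosed.preimage A.continuous_π₁) fun m hm p _ => ?_
  exact (congrArg (· ∈ K) (A.r_proj p m)).mpr hm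

theorem isProperMap_proj [LocallyCompactSpace X] (p : P) :
    IsProperMap fun m : A.H0 => m.1 p := by
  refine isProperMap_of_comp_of_t2 (A.continuous_proj p) (A.isProperMap_r p).continuous ?_
  convert A.isProperMap_π₁ using 1
  exact funext (A.r_proj p)

theorem locallyCompactSpace_H0 [LocallyCompactSpace X] : LocallyCompactSpace A.H0 := by
  have : WeaklyLocallyCompactSpace A.H0 := ⟨fun m => by
    obtain ⟨K, hK, hmK⟩ := exists_compact_mem_nhds (A.π₁ m)
    exact ⟨_, A.isProperMap_π₁.isCompact_preimage hK, A.continuous_π₁.continuousAt hmK⟩⟩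
  infer_instance

end Compactness

end ProperCorrAction

/-! ### Radon measures on the space of histories and projective limits -/

theorem IsProperMap.isLocallyFiniteMeasure_map {Y Z : Type*} [TopologicalSpace Y]
    [TopologicalSpace Z] [MeasurableSpace Y] [BorelSpace Y] [MeasurableSpace Z] [BorelSpace Z]
    [T2Space Z] [WeaklyLocallyCompactSpace Z] {f : Y → Z} (hf : IsProperMap f) (μ : Measure Y)
    [IsFiniteMeasureOnCompacts μ] : IsLocallyFiniteMeasure (μ.map f) := by
  refine ⟨fun z => ?_⟩
  obtain ⟨K, hK, hzK⟩ := exists_compact_mem_nhds z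
  refine ⟨K, hzK, ?_⟩
  rw [Measure.map_apply hf.continuous.measurable hK.measurableSet]
  exact (hf.isCompact_preimage hK).measure_lt_top

theorem MeasureTheory.Measure.Regular.ext_isCompact {Y : Type*} [TopologicalSpace Y]
    [MeasurableSpace Y] {μ ν : Measure Y} [μ.Regular] [ν.Regular]
    (h : ∀ K, IsCompact K → μ K = ν K) : μ = ν := by
  apply Measure.OuterRegular.ext_isOpen
  apply Measure.InnerRegularWRT.eq_of_innerRegularWRT_of_forall_eq Measure.Regular.innerRegular
    Measure.Regular.innerRegular
  exact h

theorem MeasureTheory.Measure.isLocallyFiniteMeasure_ofReal_smul {Y : Type*} [TopologicalSpace Y]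
    [MeasurableSpace Y] (a : ℝ) (μ : Measure Y) [IsLocallyFiniteMeasure μ] :
    IsLocallyFiniteMeasure (ENNReal.ofReal a • μ) :=
  inferInstanceAs (IsLocallyFiniteMeasure (a.toNNReal • μ))

namespace ProperCorrAction

variable {P : Type w} [Monoid P] [RightOreMonoid P] {X : Type u} [TopologicalSpace X]
  {M : P → Type v} [∀ p, TopologicalSpace (M p)] (A : ProperCorrAction P X M)

/-- Neighbourhood filters in `H⁰` are infima of those pulled back from the `M a`; the infimum is
directed by common multiples, and multiples of the fixed `p` are cofinal. -/
theorem isTopologicalBasis_preimage_proj (p : P) :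
    IsTopologicalBasis {W : Set A.H0 | ∃ (q t : P) (_ : p * q = t) (U : Set (M t)),
      IsOpen U ∧ (fun m : A.H0 => m.1 t) ⁻¹' U = W} := by
  refine isTopologicalBasis_of_isOpen_of_nhds ?_ fun m W hm hW => ?_
  · rintro _ ⟨q, t, h, U, hU, rfl⟩
    exact hU.preimage (A.continuous_proj t)
  have hle : ∀ {a b t : P}, a * b = t →
      Filter.comap (fun m : A.H0 => m.1 t) (nhds (m.1 t)) ≤
        Filter.comap (fun m : A.H0 => m.1 a) (nhds (m.1 a)) := by
    intro a b t h
    have h1 : (fun m : A.H0 => m.1 a) = A.rr h ∘ fun m : A.H0 => m.1 t :=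
      funext fun m => (A.rr_proj h m).symm
    rw [h1, ← Filter.comap_comap, ← A.rr_proj h m]
    exact Filter.comap_mono (A.continuous_rr h).continuousAt.tendsto.le_comap
  have hnhds : nhds m = ⨅ a, Filter.comap (fun m : A.H0 => m.1 a) (nhds (m.1 a)) := by
    refine (nhds_induced (Subtype.val : A.H0 → ∀ p, M p) m).trans ?_
    rw [nhds_pi, Filter.pi, Filter.comap_iInf]
    exact iInf_congr fun a => Filter.comap_comap
  have hdir : Directed (· ≥ ·)
      fun a => Filter.comap (fun m : A.H0 => m.1 a) (nhds (m.1 a)) := by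
    intro a b
    obtain ⟨y, z, h⟩ := RightOreMonoid.exists_mul_eq a b
    exact ⟨a * y, hle rfl, hle h.symm⟩
  have hW' := hW.mem_nhds hm
  rw [hnhds, Filter.mem_iInf_of_directed hdir] at hW'
  obtain ⟨a, ha⟩ := hW'
  obtain ⟨q, y, h⟩ := RightOreMonoid.exists_mul_eq p a
  obtain ⟨V, hV, hVW⟩ := Filter.mem_comap.1 (hle h.symm ha)
  obtain ⟨U, hUV, hU, hmU⟩ := mem_nhds_iff.1 hV
  exact ⟨_, ⟨q, _, rfl, U, hU, rfl⟩, hmU, (preimage_mono hUV).trans hVW⟩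

/-- The open sets of pairs that differ at stage `p` cover the compact set `K × L` and grow along
multiples, so one of them suffices. -/
theorem exists_disjoint_image_proj [∀ p, T2Space (M p)] {K L : Set A.H0} (hK : IsCompact K)
    (hL : IsCompact L)
    (hKL : Disjoint K L) : ∃ p, ∀ (q t : P), p * q = t →
      Disjoint ((fun m : A.H0 => m.1 t) '' K) ((fun m : A.H0 => m.1 t) '' L) := by
  have hmono : ∀ {p q t : P}, p * q = t → ∀ z : A.H0 × A.H0,
      z.1.1 p ≠ z.2.1 p → z.1.1 t ≠ z.2.1 t := by
    intro p q t h z hz hz'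
    rw [← A.rr_proj h, ← A.rr_proj h, hz'] at hz
    exact hz rfl
  obtain ⟨p, hp⟩ := (hK.prod hL).elim_directed_cover
    (fun p : P => {z : A.H0 × A.H0 | z.1.1 p ≠ z.2.1 p})
    (fun p => (isClosed_eq ((A.continuous_proj p).comp continuous_fst)
      ((A.continuous_proj p).comp continuous_snd)).isOpen_compl)
    (by
      rintro ⟨x, y⟩ ⟨hx, hy⟩
      by_contra hxy
      simp only [mem_iUnion, mem_ofPred_eq, not_exists, not_not] at hxy
      exact disjoint_left.1 hKL hx (A.H0_ext hxy ▸ hy))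
    (by
      intro a b
      obtain ⟨y, z, h⟩ := RightOreMonoid.exists_mul_eq a b
      exact ⟨a * y, hmono rfl, hmono h.symm⟩)
  refine ⟨p, fun q t h => disjoint_left.2 ?_⟩
  rintro _ ⟨x, hx, rfl⟩ ⟨y, hy, hxy⟩
  exact hmono h (x, y) (hp ⟨hx, hy⟩) hxy.symm

variable [T2Space X] [LocallyCompactSpace X] [SecondCountableTopology X]
  [∀ p, MeasurableSpace (M p)] [∀ p, BorelSpace (M p)]

/-- A measure on `H⁰` is determined by its images in the spaces `M (p q)`. -/
theorem measure_ext_of_map_proj [Countable P] (p : P) {μ μ' : Measure A.H0}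
    [IsLocallyFiniteMeasure μ]
    (h : ∀ q t : P, p * q = t →
      μ.map (fun m : A.H0 => m.1 t) = μ'.map (fun m : A.H0 => m.1 t)) : μ = μ' := by
  have := A.secondCountableTopology_H0
  have hb := A.isTopologicalBasis_preimage_proj p
  have hex : ∀ m : A.H0, ∃ W ∈ {W : Set A.H0 | ∃ (q t : P) (_ : p * q = t) (U : Set (M t)),
      IsOpen U ∧ (fun m : A.H0 => m.1 t) ⁻¹' U = W}, m ∈ W ∧ μ W < ⊤ := by
    intro m
    obtain ⟨V, hmV, hV, hlt⟩ := μ.exists_isOpen_measure_lt_top m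
    obtain ⟨W, hW, hmW, hWV⟩ := hb.exists_subset_of_mem_open hmV hV
    exact ⟨W, hW, hmW, (measure_mono hWV).trans_lt hlt⟩
  choose W hW hmW hlt using hex
  obtain ⟨T, hTc, hT⟩ := countable_cover_nhds (f := W)
    fun m => (hb.isOpen (hW m)).mem_nhds (hmW m)
  refine Measure.ext_of_generateFrom_of_cover_subset (T := W '' T)
    (hb.borel_eq_generateFrom ▸ BorelSpace.measurable_eq) ?_ ?_ (hTc.image W)
    (by rwa [sUnion_image]) ?_ ?_
  · rintro _ ⟨q, _, rfl, U, hU, rfl⟩ _ ⟨q', _, rfl, U', hU', rfl⟩ -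
    -- Two basic sets live over a common multiple, where their intersection is again basic.
    obtain ⟨y, z, hyz⟩ := RightOreMonoid.exists_mul_eq (p * q) (p * q')
    refine ⟨q * y, p * q * y, (mul_assoc _ _ _).symm, A.rr rfl ⁻¹' U ∩ A.rr hyz.symm ⁻¹' U',
      (hU.preimage (A.continuous_rr _)).inter (hU'.preimage (A.continuous_rr _)), ?_⟩
    ext m
    simp only [mem_preimage, mem_inter_iff, rr_proj]
  · rintro _ ⟨m, -, rfl⟩
    exact hW m
  · rintro _ ⟨m, -, rfl⟩
    exact (hlt m).ne
  · rintro _ ⟨q, t, ht, U, hU, rfl⟩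
    have hm := (A.continuous_proj t).measurable
    rw [← Measure.map_apply hm hU.measurableSet, h q t ht, Measure.map_apply hm hU.measurableSet]

section Projective

variable {A} [∀ p, T2Space (M p)] {ρ : ∀ p, Measure (M p)} [∀ p, (ρ p).Regular]

/-- A projective family of Radon measures on the spaces `M p` has a limit on `H⁰`. -/
theorem exists_regular_map_proj_eq [∀ p, LocallyCompactSpace (M p)]
    (hρ : ∀ {p q t : P} (h : p * q = t), (ρ t).map (A.rr h) = ρ p) :
    ∃ μ : Measure A.H0, μ.Regular ∧ ∀ p, μ.map (fun m : A.H0 => m.1 p) = ρ p := by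
  have := A.locallyCompactSpace_H0
  have := A.secondCountable_M
  have hpre : ∀ {p q t : P} (h : p * q = t) {B : Set (M p)}, MeasurableSet B →
      ρ t (A.rr h ⁻¹' B) = ρ p B := fun h B hB => by
    rw [← Measure.map_apply (A.continuous_rr h).measurable hB, hρ h]
  have hcpt : ∀ (p : P) {K : Set A.H0}, IsCompact K → IsCompact ((fun m : A.H0 => m.1 p) '' K) :=
    fun p K hK => hK.image (A.continuous_proj p)
  have hanti : ∀ {p q t : P}, p * q = t → ∀ {K : Set A.H0}, IsCompact K →
      ρ t ((fun m : A.H0 => m.1 t) '' K) ≤ ρ p ((fun m : A.H0 => m.1 p) '' K) := by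
    intro p q t h K hK
    rw [← hpre h (hcpt p hK).measurableSet]
    refine measure_mono ?_
    rintro _ ⟨m, hm, rfl⟩
    exact ⟨m, hm, (A.rr_proj h m).symm⟩
  -- By `hanti` the values decrease along multiples, so this infimum is a directed limit and hence
  -- additive in the sense of `hLadd`.
  let L : Set A.H0 → ENNReal := fun K => ⨅ p, ρ p ((fun m : A.H0 => m.1 p) '' K)
  have hLtop : ∀ {K : Set A.H0}, IsCompact K → L K ≠ ⊤ := fun hK =>
    ((iInf_le _ 1).trans_lt (hcpt 1 hK).measure_lt_top).ne
  have hLmono : ∀ {K K' : Set A.H0}, K ⊆ K' → L K ≤ L K' := fun h =>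
    iInf_mono fun p => measure_mono (image_mono h)
  have hLadd : ∀ {K K' : Set A.H0}, IsCompact K → IsCompact K' → L K + L K' =
      ⨅ p, (ρ p ((fun m : A.H0 => m.1 p) '' K) + ρ p ((fun m : A.H0 => m.1 p) '' K')) := by
    intro K K' hK hK'
    refine ENNReal.iInf_add_iInf fun a b => ?_
    obtain ⟨y, z, h⟩ := RightOreMonoid.exists_mul_eq a b
    exact ⟨a * y, add_le_add (hanti rfl hK) (hanti h.symm hK')⟩
  have hLsup : ∀ {K K' : Set A.H0}, IsCompact K → IsCompact K' → L (K ∪ K') ≤ L K + L K' := by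
    intro K K' hK hK'
    rw [hLadd hK hK']
    refine iInf_mono fun p => ?_
    rw [image_union]
    exact measure_union_le _ _
  have hLdisj : ∀ {K K' : Set A.H0}, IsCompact K → IsCompact K' → Disjoint K K' →
      L (K ∪ K') = L K + L K' := by
    intro K K' hK hK' hd
    refine le_antisymm (hLsup hK hK') ?_
    rw [hLadd hK hK']
    obtain ⟨a, ha⟩ := A.exists_disjoint_image_proj hK hK' hd
    refine le_iInf fun p => ?_
    obtain ⟨y, z, h⟩ := RightOreMonoid.exists_mul_eq a p
    refine (iInf_le _ (a * y)).trans ?_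
    rw [← measure_union (ha y _ rfl) (hcpt _ hK').measurableSet, ← image_union]
    exact hanti h.symm (hK.union hK')
  let κ : Content A.H0 :=
    { toFun := fun K => (L K).toNNReal
      mono' := fun K K' h => ENNReal.toNNReal_mono (hLtop K'.isCompact) (hLmono h)
      sup_disjoint' := fun K K' hd _ _ => by
        rw [Compacts.coe_sup, hLdisj K.isCompact K'.isCompact hd,
          ENNReal.toNNReal_add (hLtop K.isCompact) (hLtop K'.isCompact)]
      sup_le' := fun K K' => by
        rw [Compacts.coe_sup,
          ← ENNReal.toNNReal_add (hLtop K.isCompact) (hLtop K'.isCompact)]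
        exact ENNReal.toNNReal_mono (ENNReal.add_ne_top.2
          ⟨hLtop K.isCompact, hLtop K'.isCompact⟩) (hLsup K.isCompact K'.isCompact) }
  have hκ : ∀ K : Compacts A.H0, κ K = L K := fun K => ENNReal.coe_toNNReal (hLtop K.isCompact)
  have hreg : κ.ContentRegular := by
    intro K
    refine le_antisymm (le_iInf₂ fun K' h => κ.mono _ _ (h.trans interior_subset)) ?_
    rw [hκ]
    -- Outer regularity of `ρ p` gives a compact neighbourhood `C` of the image of `K` with measure
    -- below `x`; its preimage is compact because the projection is proper.
    refine le_iInf fun p => le_of_forall_gt fun x hx => ?_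
    obtain ⟨U, hKU, hU, hUx⟩ := Set.exists_isOpen_lt_of_lt _ x hx
    obtain ⟨C, hC, hKC, hCU⟩ := exists_compact_between (hcpt p K.isCompact) hU hKU
    let K' : Compacts A.H0 :=
      ⟨(fun m : A.H0 => m.1 p) ⁻¹' C, (A.isProperMap_proj p).isCompact_preimage hC⟩
    have hKK' : (K : Set A.H0) ⊆ interior K' := Subset.trans
      (image_subset_iff.1 hKC : (K : Set A.H0) ⊆ (fun m : A.H0 => m.1 p) ⁻¹' interior C)
      (preimage_interior_subset_interior_preimage (A.continuous_proj p))
    refine (iInf₂_le K' hKK').trans_lt (lt_of_le_of_lt ?_ hUx)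
    rw [hκ]
    exact (iInf_le _ p).trans (measure_mono ((image_preimage_subset _ _).trans hCU))
  -- The crucial bound: points of `C` that do not extend to complete histories carry no mass. If `U`
  -- is an open neighbourhood of the extendable part at stage `p e`, compactness gives a later stage
  -- at which everything over `C` already lies over `U`.
  have hle : ∀ {p : P} {C : Set (M p)}, IsCompact C →
      ρ p C ≤ L ((fun m : A.H0 => m.1 p) ⁻¹' C) := by
    intro p C hC
    have hC' := (A.isProperMap_proj p).isCompact_preimage hC
    refine le_iInf fun q => ?_
    obtain ⟨e, y, h⟩ := RightOreMonoid.exists_mul_eq p q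
    refine le_trans ?_ (hanti h.symm hC')
    rw [Set.measure_eq_iInf_isOpen ((fun m : A.H0 => m.1 (p * e)) '' _)]
    refine le_iInf fun U => le_iInf fun hCU => le_iInf fun hU => ?_
    obtain ⟨d, hd⟩ := A.exists_forall_rr_notMem (p := p * e) (K := A.rr rfl ⁻¹' C \ U)
      (((A.isProperMap_rr rfl).isCompact_preimage hC).diff hU) (by
        rintro m ⟨hm, hmU⟩
        refine hmU (hCU ⟨m, ?_, rfl⟩)
        rwa [mem_preimage, rr_proj] at hm)
    have hped : p * (e * d) = p * e * d := (mul_assoc _ _ _).symm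
    rw [← hpre hped hC.measurableSet, ← hpre (rfl : p * e * d = p * e * d) hU.measurableSet]
    refine measure_mono fun x hx => ?_
    by_contra hxU
    refine hd x ⟨?_, hxU⟩
    rw [mem_preimage, A.rr_rr rfl rfl rfl hped]
    exact hx
  refine ⟨κ.measure, inferInstance, fun p => ?_⟩
  have := (A.isProperMap_proj p).isLocallyFiniteMeasure_map κ.measure
  have : SigmaCompactSpace (M p) := inferInstance
  refine Measure.Regular.ext_isCompact fun C hC => ?_
  have hC' := (A.isProperMap_proj p).isCompact_preimage hC
  rw [Measure.map_apply (A.continuous_proj p).measurable hC.measurableSet]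
  refine (κ.measure_eq_content_of_regular hreg ⟨_, hC'⟩).trans ((hκ _).trans ?_)
  exact le_antisymm ((iInf_le _ p).trans (measure_mono (image_preimage_subset _ _))) (hle hC)

end Projective

end ProperCorrAction

theorem ofReal_val_mul (x y : {x : ℝ // 0 < x}) : ENNReal.ofReal ((x * y : {x : ℝ // 0 < x}) : ℝ) =
    ENNReal.ofReal (x : ℝ) * ENNReal.ofReal (y : ℝ) :=
  ENNReal.ofReal_mul x.2.le

/-! ### Invariance: consistency of marginals, bisections and shifts -/

namespace ProperCorrAction

variable {P : Type w} [Monoid P] {X : Type u} [TopologicalSpace X]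
  {M : P → Type v} [∀ p, TopologicalSpace (M p)] (A : ProperCorrAction P X M)

theorem map_π₁_eq [MeasurableSpace X] [BorelSpace X] [∀ p, MeasurableSpace (M p)]
    [∀ p, BorelSpace (M p)] (p : P) (μ : Measure A.H0) :
    μ.map A.π₁ = (μ.map fun m : A.H0 => m.1 p).map (A.r p) := by
  rw [Measure.map_map (A.isProperMap_r p).continuous.measurable (A.continuous_proj p).measurable]
  congr 1
  exact funext fun m => (A.r_proj p m).symm

theorem map_rr_pullback [T2Space X] [LocallyCompactSpace X] [SecondCountableTopology X]
    [∀ p, T2Space (M p)] [MeasurableSpace X] [BorelSpace X] [∀ p, MeasurableSpace (M p)]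
    [∀ p, BorelSpace (M p)] {c : P →* {x : ℝ // 0 < x}}
    {ν : Measure X} [IsLocallyFiniteMeasure ν]
    (hν : A.IsInvariantX c ν) {p q t : P} (h : p * q = t) :
    (ENNReal.ofReal (c t : ℝ) • pullback (A.s t) ν).map (A.rr h) =
      ENNReal.ofReal (c p : ℝ) • pullback (A.s p) ν := by
  have := A.secondCountable_M
  have hs : A.s t = A.s q ∘ A.ss h := funext fun m => (A.s_ss h m).symm
  -- Replacing `ν` by `c(q) (r_q)_* s_q^* ν` puts the right side in the form produced by base change
  -- along `M (p q) ≅ M p ×_X M q`.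
  conv_rhs => rw [hν q]
  rw [hs, ← pullback_pullback (A.isLocalHomeomorph_ss h) (A.isLocalHomeomorph_s q),
    Measure.map_smul, map_pullback_of_bijOn (A.isLocalHomeomorph_s p) (A.isLocalHomeomorph_ss h)
      (A.continuous_rr h).measurable (A.isProperMap_r q).continuous.measurable (A.bijOn_rr h),
    pullback_smul, smul_smul, ← h, map_mul, ofReal_val_mul]

variable [RightOreMonoid P]

section Bisections

theorem extend_mk (c : P →* {x : ℝ // 0 < x}) (p q : P) :
    FracGroup.extend c (FracGroup.mk p q) = c p / c q := rfl

/-- The graph of `s̃_p` over an open set on which `s̃_p` is injective is a bisection. -/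
theorem isBisection_graph_shift (p : P) {U : Set A.H0} (hU : IsOpen U)
    (hinj : InjOn (A.shift p) U) :
    A.IsBisection {a | A.degree a = FracGroup.mk p 1 ∧ A.range a ∈ U ∧
      A.shift p (A.range a) = A.source a} := by
  refine ⟨?_, ?_, ?_⟩
  · rw [isOpen_coinduced, isOpen_sigma_iff]
    rintro ⟨p₁, p₂⟩
    by_cases hg : FracGroup.mk p₁ p₂ = FracGroup.mk p 1
    · obtain ⟨t₁, t₂, h₁, h₂⟩ := Quotient.exact hg
      dsimp only at h₁ h₂
      rw [one_mul] at h₂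
      have hU' : IsOpen {z : A.H1Piece p₁ p₂ | z.1.1 ∈ U} :=
        hU.preimage (continuous_fst.comp continuous_subtype_val)
      -- The two maps to `H⁰` agree after the shift by `t₂`, which is locally injective, so they
      -- agree on an open set.
      have hE : IsOpen {z : A.H1Piece p₁ p₂ | A.shift p z.1.1 = z.1.2} := by
        refine (A.isLocalHomeomorph_shift t₂).isLocallyInjective.isOpen_eqLocus
          (g₁ := fun z : A.H1Piece p₁ p₂ => A.shift p z.1.1) (g₂ := fun z => z.1.2)
          ((A.continuous_shift p).comp (continuous_fst.comp continuous_subtype_val))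
          (continuous_snd.comp continuous_subtype_val) (funext fun z => ?_)
        have hz := congrArg (A.shift t₁) z.2
        rw [A.shift_shift h₁, A.shift_shift h₂] at hz
        exact (A.shift_shift rfl z.1.1).trans hz
      convert hU'.inter hE using 1
      ext z
      exact ⟨fun h => h.2, fun h => ⟨hg, h⟩⟩
    · convert isOpen_empty using 1
      exact eq_empty_of_forall_notMem fun z hz => hg hz.1
  · rintro a ha b hb hab
    refine Subtype.ext (Prod.ext hab (Prod.ext (ha.1.trans hb.1.symm) ?_))
    exact ha.2.2.symm.trans ((congrArg _ hab).trans hb.2.2)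
  · rintro a ha b hb (hab : A.source a = A.source b)
    have h : A.range a = A.range b := hinj ha.2.1 hb.2.1 (by rw [ha.2.2, hb.2.2, hab])
    exact Subtype.ext (Prod.ext h (Prod.ext (ha.1.trans hb.1.symm) hab))

theorem image_range_graph_shift (p : P) (U : Set A.H0) :
    A.range '' {a | A.degree a = FracGroup.mk p 1 ∧ A.range a ∈ U ∧
      A.shift p (A.range a) = A.source a} = U := by
  ext x
  constructor
  · rintro ⟨a, ha, rfl⟩
    exact ha.2.1
  · intro hx
    refine ⟨⟨(x, FracGroup.mk p 1, A.shift p x), p, 1, rfl, ?_⟩, ⟨rfl, hx, rfl⟩, rfl⟩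
    exact (A.shift_shift (mul_one p) x).symm

theorem image_source_graph_shift (p : P) (U : Set A.H0) :
    A.source '' {a | A.degree a = FracGroup.mk p 1 ∧ A.range a ∈ U ∧
      A.shift p (A.range a) = A.source a} = A.shift p '' U := by
  conv_rhs => rw [← A.image_range_graph_shift p U, image_image]
  exact image_congr fun a ha => ha.2.2.symm

/-- A basic subset of `H¹_g`, given by a representation of `g` and two open sets. -/
def arrowBox (j : (P × P) × Set A.H0 × Set A.H0) : Set A.H1 :=
  {a | A.degree a = FracGroup.mk j.1.1 j.1.2 ∧ A.range a ∈ j.2.1 ∧ A.source a ∈ j.2.2 ∧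
    A.shift j.1.1 (A.range a) = A.shift j.1.2 (A.source a)}

theorem image_range_arrowBox (j : (P × P) × Set A.H0 × Set A.H0) :
    A.range '' A.arrowBox j = j.2.1 ∩ A.shift j.1.1 ⁻¹' (A.shift j.1.2 '' j.2.2) := by
  ext x
  constructor
  · rintro ⟨a, ha, rfl⟩
    exact ⟨ha.2.1, A.source a, ha.2.2.1, ha.2.2.2.symm⟩
  · rintro ⟨hx, y, hy, h⟩
    exact ⟨⟨(x, FracGroup.mk j.1.1 j.1.2, y), j.1.1, j.1.2, rfl, h.symm⟩,
      ⟨rfl, hx, hy, h.symm⟩, rfl⟩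

theorem image_source_arrowBox (j : (P × P) × Set A.H0 × Set A.H0) :
    A.source '' A.arrowBox j = j.2.2 ∩ A.shift j.1.2 ⁻¹' (A.shift j.1.1 '' j.2.1) := by
  ext y
  constructor
  · rintro ⟨a, ha, rfl⟩
    exact ⟨ha.2.2.1, A.range a, ha.2.1, ha.2.2.2⟩
  · rintro ⟨hy, x, hx, h⟩
    exact ⟨⟨(x, FracGroup.mk j.1.1 j.1.2, y), j.1.1, j.1.2, rfl, h⟩, ⟨rfl, hx, hy, h⟩, rfl⟩

/-- An open subset of `H¹` is a countable union of basic sets on which the shifts are injective. -/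
theorem exists_countable_cover_arrowBox [Countable P] [SecondCountableTopology A.H0]
    {B : Set A.H1} (hB : IsOpen B) :
    ∃ J : Set ((P × P) × Set A.H0 × Set A.H0), J.Countable ∧
      (∀ j ∈ J, IsOpen j.2.1 ∧ IsOpen j.2.2 ∧ InjOn (A.shift j.1.1) j.2.1 ∧
        InjOn (A.shift j.1.2) j.2.2) ∧ ⋃ j ∈ J, A.arrowBox j = B := by
  let J : Set ((P × P) × Set A.H0 × Set A.H0) :=
    {j | j ∈ univ ×ˢ (countableBasis A.H0 ×ˢ countableBasis A.H0) ∧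
      InjOn (A.shift j.1.1) j.2.1 ∧ InjOn (A.shift j.1.2) j.2.2 ∧ A.arrowBox j ⊆ B}
  refine ⟨J, ?_, ?_, ?_⟩
  · exact (countable_univ.prod ((countable_countableBasis _).prod
      (countable_countableBasis _))).mono fun j hj => hj.1
  · rintro j ⟨⟨-, h1, h2⟩, h3, h4, -⟩
    exact ⟨isOpen_of_mem_countableBasis h1, isOpen_of_mem_countableBasis h2, h3, h4⟩
  · refine Subset.antisymm (iUnion₂_subset fun j hj => hj.2.2.2) ?_
    rintro ⟨⟨x, g, y⟩, p₁, p₂, hg, hxy⟩ hb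
    dsimp only at hg hxy
    subst hg
    rw [isOpen_coinduced, isOpen_sigma_iff] at hB
    obtain ⟨O, hO, hOB⟩ := isOpen_induced_iff.1 (hB (p₁, p₂))
    have hmem : ∀ z : A.H1Piece p₁ p₂, z.1 ∈ O ↔ A.fromPieces ⟨(p₁, p₂), z⟩ ∈ B := fun z =>
      Set.ext_iff.1 hOB z
    obtain ⟨V, W, hV, hW, hxV, hyW, hVW⟩ := isOpen_prod_iff.1 hO x y ((hmem ⟨(x, y), hxy⟩).2 hb)
    obtain ⟨V', hV', hxV', hVinj⟩ := (A.isLocalHomeomorph_shift p₁).isLocallyInjective x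
    obtain ⟨W', hW', hyW', hWinj⟩ := (A.isLocalHomeomorph_shift p₂).isLocallyInjective y
    obtain ⟨V₀, hV₀, hxV₀, hV₀s⟩ := (isBasis_countableBasis A.H0).exists_subset_of_mem_open
      (⟨hxV, hxV'⟩ : x ∈ V ∩ V') (hV.inter hV')
    obtain ⟨W₀, hW₀, hyW₀, hW₀s⟩ := (isBasis_countableBasis A.H0).exists_subset_of_mem_open
      (⟨hyW, hyW'⟩ : y ∈ W ∩ W') (hW.inter hW')
    refine mem_iUnion₂.2 ⟨((p₁, p₂), V₀, W₀), ⟨⟨mem_univ _, hV₀, hW₀⟩,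
      hVinj.mono fun _ h => (hV₀s h).2, hWinj.mono fun _ h => (hW₀s h).2, ?_⟩,
      ⟨rfl, hxV₀, hyW₀, hxy⟩⟩
    rintro ⟨⟨x', g, y'⟩, h⟩ ⟨rfl, hx', hy', hxy'⟩
    exact (hmem ⟨(x', y'), hxy'⟩).1 (hVW ⟨(hV₀s hx').1, (hW₀s hy').1⟩)

end Bisections

variable [Countable P] [T2Space X] [LocallyCompactSpace X] [SecondCountableTopology X]
  [∀ p, T2Space (M p)]

/-- The shifts by `p₁` and `p₂` carry range and source of `D` injectively onto one common set, so
their measures are `c(p₁)` and `c(p₂)` times the measure of that set. -/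
theorem measure_image_range_of_subset_arrowBox {c : P →* {x : ℝ // 0 < x}} {μ : Measure A.H0}
    (hμ : ∀ p, μ = ENNReal.ofReal (c p : ℝ) • pullback (A.shift p) μ)
    {j : (P × P) × Set A.H0 × Set A.H0} (hj₁ : InjOn (A.shift j.1.1) j.2.1)
    (hj₂ : InjOn (A.shift j.1.2) j.2.2) {D : Set A.H1} (hD : D ⊆ A.arrowBox j)
    (hr : MeasurableSet (A.range '' D)) (hs : MeasurableSet (A.source '' D)) :
    μ (A.range '' D) = ENNReal.ofReal (FracGroup.extend c (FracGroup.mk j.1.1 j.1.2) : ℝ) *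
      μ (A.source '' D) := by
  have := A.secondCountableTopology_H0
  have key : ∀ (p : P) {E : Set A.H0}, MeasurableSet E → InjOn (A.shift p) E →
      μ E = ENNReal.ofReal (c p : ℝ) * μ (A.shift p '' E) := fun p E hE hinj => by
    conv_lhs => rw [hμ p]
    rw [Measure.smul_apply, pullback_apply_of_injOn (A.isLocalHomeomorph_shift p) μ hE hinj,
      smul_eq_mul]
  have h₁ : A.range '' D ⊆ j.2.1 := by
    rintro _ ⟨a, ha, rfl⟩
    exact (hD ha).2.1
  have h₂ : A.source '' D ⊆ j.2.2 := by
    rintro _ ⟨a, ha, rfl⟩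
    exact (hD ha).2.2.1
  have himg : A.shift j.1.1 '' (A.range '' D) = A.shift j.1.2 '' (A.source '' D) := by
    rw [image_image, image_image]
    exact image_congr fun a ha => (hD ha).2.2.2
  rw [key _ hr (hj₁.mono h₁), key _ hs (hj₂.mono h₂), himg, ← mul_assoc,
    ← ofReal_val_mul, extend_mk, div_mul_cancel]

/-- Invariance under bisections is invariance under the shifts. -/
theorem isInvariantH0_iff (c : P →* {x : ℝ // 0 < x}) (μ : Measure A.H0)
    [IsLocallyFiniteMeasure μ] : A.IsInvariantH0 c μ ↔
      ∀ p, μ = ENNReal.ofReal (c p : ℝ) • pullback (A.shift p) μ := by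
  have := A.secondCountableTopology_H0
  constructor
  · intro h p
    have := Measure.isLocallyFiniteMeasure_ofReal_smul (c p : ℝ) μ
    rw [← pullback_smul]
    refine eq_pullback_of_isOpen (A.isLocalHomeomorph_shift p) _ fun U hU hinj => ?_
    have hB := h _ _ (A.isBisection_graph_shift p hU hinj) fun b hb => hb.1
    rw [image_range_graph_shift, image_source_graph_shift, extend_mk, map_one, div_one] at hB
    rw [hB, Measure.smul_apply, smul_eq_mul]
  · intro hμ g B hB hg
    obtain ⟨J, hJc, hJ, hJB⟩ := A.exists_countable_cover_arrowBox hB.1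
    rcases J.eq_empty_or_nonempty with rfl | hne
    · have : B = ∅ := by simpa using hJB.symm
      simp [this]
    obtain ⟨e, rfl⟩ := hJc.exists_eq_range hne
    rw [biUnion_range] at hJB
    have he := fun n => hJ (e n) (mem_range_self n)
    set N : ℕ → Set A.H1 := fun n => A.arrowBox (e n) with hN
    have hNB : ∀ n, N n ⊆ B := fun n => hJB ▸ subset_iUnion N n
    have himage : ∀ f : A.H1 → A.H0, InjOn f B → (∀ n, MeasurableSet (f '' N n)) →
        (∀ n, MeasurableSet (f '' disjointed N n)) ∧
          μ (f '' B) = ∑' n, μ (f '' disjointed N n) := by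
      intro f hf hm
      -- Injectivity of `f` on `B` lets images commute with the differences that make the pieces
      -- disjoint, so measurability is needed only for images of boxes, which are open.
      have hd : ∀ n, f '' disjointed N n = disjointed (fun n => f '' N n) n := by
        intro n
        rw [disjointed_eq_inter_compl, disjointed_eq_inter_compl]
        ext x
        simp only [mem_image, mem_inter_iff, mem_iInter, mem_compl_iff]
        constructor
        · rintro ⟨a, ⟨ha, hna⟩, rfl⟩
          refine ⟨⟨a, ha, rfl⟩, fun k hk => ?_⟩
          rintro ⟨b, hb, hab⟩
          exact hna k hk (hf (hNB k hb) (hNB n ha) hab ▸ hb)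
        · rintro ⟨⟨a, ha, rfl⟩, h⟩
          exact ⟨a, ⟨ha, fun k hk hak => h k hk ⟨a, hak, rfl⟩⟩, rfl⟩
      have hdm : ∀ n, MeasurableSet (f '' disjointed N n) := fun n => by
        rw [hd n]
        exact MeasurableSet.disjointed hm n
      refine ⟨hdm, ?_⟩
      rw [← measure_iUnion _ hdm, ← image_iUnion, iUnion_disjointed, hJB]
      intro i j hij
      simp only [Function.onFun, hd]
      exact disjoint_disjointed _ hij
    obtain ⟨hrm, hr⟩ := himage A.range hB.2.1 fun n => by
      rw [hN, image_range_arrowBox]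
      exact ((he n).1.inter (((A.isLocalHomeomorph_shift _).isOpenMap _ (he n).2.1).preimage
        (A.continuous_shift _))).measurableSet
    obtain ⟨hsm, hs⟩ := himage A.source hB.2.2 fun n => by
      rw [hN, image_source_arrowBox]
      exact ((he n).2.1.inter (((A.isLocalHomeomorph_shift _).isOpenMap _ (he n).1).preimage
        (A.continuous_shift _))).measurableSet
    rw [hr, hs, ← ENNReal.tsum_mul_left]
    refine tsum_congr fun n => ?_
    rcases (disjointed N n).eq_empty_or_nonempty with h | ⟨b, hb⟩
    · simp [h]
    have hbN : b ∈ A.arrowBox (e n) := disjointed_subset N n hb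
    rw [← hg b (hNB n hbN), hbN.1]
    exact A.measure_image_range_of_subset_arrowBox hμ (he n).2.2.1 (he n).2.2.2
      (disjointed_subset N n) (hrm n) (hsm n)

variable [MeasurableSpace X] [BorelSpace X] [∀ p, MeasurableSpace (M p)] [∀ p, BorelSpace (M p)]

theorem map_proj_of_invariant {c : P →* {x : ℝ // 0 < x}} {μ : Measure A.H0} {p : P}
    (hμ : μ = ENNReal.ofReal (c p : ℝ) • pullback (A.shift p) μ) :
    μ.map (fun m : A.H0 => m.1 p) =
      ENNReal.ofReal (c p : ℝ) • pullback (A.s p) (μ.map A.π₁) := by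
  have := A.secondCountableTopology_H0
  have := A.secondCountable_M
  conv_lhs => rw [hμ]
  rw [Measure.map_smul, map_pullback_of_bijOn (A.isLocalHomeomorph_s p)
    (A.isLocalHomeomorph_shift p) (A.continuous_proj p).measurable A.continuous_π₁.measurable
    (A.bijOn_proj p)]

/-- Base change along `H⁰ ≅ M p ×_X H⁰` turns the marginal at `p q` into a pull-back of the marginal
of `μ` at `q`; then `s_{p,q}` and `s_q` compose to `s_{pq}`. -/
theorem map_proj_smul_pullback_shift {c : P →* {x : ℝ // 0 < x}} {ν : Measure X}
    [IsLocallyFiniteMeasure ν] {μ : Measure A.H0}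
    (hμ : ∀ p, μ.map (fun m : A.H0 => m.1 p) = ENNReal.ofReal (c p : ℝ) • pullback (A.s p) ν)
    {p q t : P} (h : p * q = t) :
    (ENNReal.ofReal (c p : ℝ) • pullback (A.shift p) μ).map (fun m : A.H0 => m.1 t) =
      ENNReal.ofReal (c t : ℝ) • pullback (A.s t) ν := by
  subst h
  have := A.secondCountableTopology_H0
  have := A.secondCountable_M
  have hs : A.s (p * q) = A.s q ∘ A.ss rfl := funext fun m => (A.s_ss rfl m).symm
  rw [Measure.map_smul, map_pullback_of_bijOn (A.isLocalHomeomorph_ss rfl)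
    (A.isLocalHomeomorph_shift p) (A.continuous_proj _).measurable
    (A.continuous_proj q).measurable (A.bijOn_proj_mul p q), hμ q, pullback_smul,
    pullback_pullback (A.isLocalHomeomorph_ss rfl) (A.isLocalHomeomorph_s q), ← hs, smul_smul,
    map_mul, ofReal_val_mul]

end ProperCorrAction

end

/-! ### The bijection -/

theorem mainTheorem11 {P : Type w} [Monoid P] [RightOreMonoid P] [Countable P]
    {X : Type u} [TopologicalSpace X] [T2Space X] [LocallyCompactSpace X]
    [SecondCountableTopology X] [MeasurableSpace X] [BorelSpace X]
    {M : P → Type v} [∀ p, TopologicalSpace (M p)] [∀ p, T2Space (M p)]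
    [∀ p, LocallyCompactSpace (M p)] [∀ p, MeasurableSpace (M p)] [∀ p, BorelSpace (M p)]
    (A : ProperCorrAction P X M) (c : P →* {x : ℝ // 0 < x}) :
    Set.BijOn (fun μ : MeasureTheory.Measure A.H0 => μ.map A.π₁)
      {μ | μ.Regular ∧ A.IsInvariantH0 c μ}
      {ν | ν.Regular ∧ A.IsInvariantX c ν} := by
  have := A.locallyCompactSpace_H0
  have := A.secondCountable_M
  refine ⟨?_, ?_, ?_⟩
  · rintro μ ⟨hμ, hinv⟩
    rw [A.isInvariantH0_iff] at hinv
    have := A.isProperMap_π₁.isLocallyFiniteMeasure_map μ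
    refine ⟨inferInstance, fun p => ?_⟩
    dsimp only
    conv_lhs => rw [A.map_π₁_eq p, A.map_proj_of_invariant (hinv p), Measure.map_smul]
  · rintro μ ⟨hμ, hinv⟩ μ' ⟨hμ', hinv'⟩ (h : μ.map A.π₁ = μ'.map A.π₁)
    rw [A.isInvariantH0_iff] at hinv hinv'
    refine A.measure_ext_of_map_proj 1 fun _ t _ => ?_
    rw [A.map_proj_of_invariant (hinv t), A.map_proj_of_invariant (hinv' t), h]
  · rintro ν ⟨hν, hinv⟩
    have (p : P) : IsLocallyFiniteMeasure (ENNReal.ofReal (c p : ℝ) • pullback (A.s p) ν) := by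
      have := isLocallyFiniteMeasure_pullback (A.isLocalHomeomorph_s p) ν
      exact Measure.isLocallyFiniteMeasure_ofReal_smul _ _
    obtain ⟨μ, hμ, hmap⟩ := A.exists_regular_map_proj_eq
      (ρ := fun p => ENNReal.ofReal (c p : ℝ) • pullback (A.s p) ν)
      fun h => A.map_rr_pullback hinv h
    refine ⟨μ, ⟨hμ, ?_⟩, ?_⟩
    · rw [A.isInvariantH0_iff]
      -- Testing only on multiples of `p` is enough, and there the marginals of the pull-back along
      -- `s̃_p` are computable.
      refine fun p => A.measure_ext_of_map_proj p fun q t h => ?_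
      rw [A.map_proj_smul_pullback_shift hmap h, hmap]
    · dsimp only
      rw [A.map_π₁_eq 1, hmap, Measure.map_smul]
      exact (hinv 1).symm
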